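/- For elements $x,y$ of a group write $[x,y]=x^{-1}y^{-1}xy$, and for $n>2$ let $[x_1,\dots,x_n]=[[x_1,\dots,x_{n-1}],x_n]$. For every integer $k\geq 1$, the Hydra group $$G(k,a,t)=\langle a,t \mid [a,\underbrace{t,\dots,t}_{k}]=1\rangle$$ is residually torsion-free nilpotent; that is, for every $g\in G(k,a,t)$ with $g\neq 1$ there is a normal subgroup $N$ of $G(k,a,t)$ with $g\notin N$ such that $G(k,a,t)/N$ is nilpotent and torsion-free (its only element of finite order is the identity). -/

import Mathlib

namespace Hydra

universe u

/-- The commutator `[x, y] = x⁻¹ y⁻¹ x y`. (Mathlib's `⁅x, y⁆` is `x y x⁻¹ y⁻¹`.) -/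
def comm {G : Type u} [Group G] (x y : G) : G := x⁻¹ * y⁻¹ * x * y

/-- The left-normed commutator `[x, y, …, y]` with `y` repeated `n` times:
`[x, y, …, y, y] = [[x, y, …, y], y]`, and just `x` for `n = 0`. -/
def iterComm {G : Type u} [Group G] (x y : G) : ℕ → G
  | 0 => x
  | n + 1 => comm (iterComm x y n) y

/-- The two generators `a` and `t`. -/
inductive Gen : Type
  | a
  | t

/-- The relator `[a, t, …, t]`, with `t` repeated `k` times, in the free group on `a` and `t`. -/
def relator (k : ℕ) : FreeGroup Gen :=
  iterComm (FreeGroup.of Gen.a) (FreeGroup.of Gen.t) k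

/-- The Hydra group `G(k, a, t) = ⟨a, t | [a, t, …, t] = 1⟩`, with `t` repeated `k` times. -/
abbrev HydraGroup (k : ℕ) : Type := PresentedGroup ({relator k} : Set (FreeGroup Gen))

/-- A group is residually `P` if for each `g ≠ 1` there is a normal subgroup `N` with `g ∉ N`
whose quotient has the property `P`. -/
def IsResidually (P : ∀ (Q : Type u) [Group Q], Prop) (G : Type u) [Group G] : Prop :=
  ∀ g : G, g ≠ 1 → ∃ (N : Subgroup G) (_ : N.Normal), g ∉ N ∧ P (G ⧸ N)

/-- A group is torsion-free nilpotent if it is nilpotent and its only element of finite order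
is `1`. -/
def IsTorsionFreeNilpotent (Q : Type u) [Group Q] : Prop :=
  Group.IsNilpotent Q ∧ ∀ q : Q, IsOfFinOrder q → q = 1

end Hydra

/-!
Write `b_i` for the commutator `[a, t, …, t]` with `i` letters `t`, so that
`t⁻¹ b_i t = b_i b_{i+1}` and `b_k = 1`. The subgroup generated by `b_0 = a, …, b_{k-1}` is normal,
and every element of the Hydra group is `x t^m` with `x` in this subgroup (`exists_eq_mul_zpow`).
If `m ≠ 0`, the exponent sum of `t` maps the element to a nontrivial element of `ℤ`.

If `m = 0`, the group is represented on the free associative algebra `ℚ⟨X_0, …, X_{k-1}⟩`: `b_i`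
acts as left multiplication by `1 + X_i` and `t⁻¹` acts as the algebra endomorphism with
`1 + X_i ↦ (1 + X_i) (1 + X_{i+1})`, where `X_k = 0`. Give `X_i` the weight `i + 1`. Both kinds of
operators are then congruent to `1` modulo operators that raise the weight, because
`X_i ↦ X_i + X_{i+1} + X_i X_{i+1}` only adds terms of larger weight. On the algebra truncated at
weight `n` they are therefore invertible and lie in a group of operators unipotent for a finite
filtration of a rational vector space (`exists_truncGroup`). Such a group is torsion-free nilpotent
(`NilpotentFiltration.isTorsionFreeNilpotent_congr`).

It remains to see that an element `x ≠ 1` acts nontrivially for large `n`, which is Magnus'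
argument (`syllProd_ne_one`). Write `x` as a reduced product of powers `b_i ^ e`. The path with one
edge for each syllable gives operators `N_i` of square zero, whose products with more factors than
the path has edges vanish, so that `X_i ↦ N_i` factors through a truncation. There `(1 + N_i) ^ e`
is `1 + e N_i`, and the entry of the product from the end of the path to its start is the product
of the exponents, which is not zero.
-/

namespace Hydra

/-! ### Unipotent groups of a filtered ring -/

/-- A multiplicative descending filtration `S 0 ≥ S 1 ≥ …` of a ring by additive subgroups, with
`1 ∈ S 0`, that reaches `0` after finitely many steps. `S 0` need not be the whole ring. -/
structure NilpotentFiltration (E : Type*) [Ring E] where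
  /-- The terms of the filtration. -/
  S : ℕ → AddSubgroup E
  one_mem : 1 ∈ S 0
  mul_mem : ∀ {i j x y}, x ∈ S i → y ∈ S j → x * y ∈ S (i + j)
  succ_le : ∀ i, S (i + 1) ≤ S i
  /-- An index at which the filtration is zero. -/
  len : ℕ
  eq_bot : S len = ⊥

namespace NilpotentFiltration

variable {E : Type*} [Ring E] (F : NilpotentFiltration E)

lemma le_zero (i : ℕ) : F.S i ≤ F.S 0 := by
  induction i with
  | zero => exact le_rfl
  | succ i ih => exact (F.succ_le i).trans ih

lemma pow_mem {x : E} (hx : x ∈ F.S 1) (n : ℕ) : x ^ n ∈ F.S n := by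
  induction n with
  | zero => simpa using F.one_mem
  | succ n ih => rw [pow_succ]; exact F.mul_mem ih hx

lemma pow_len_eq_zero {x : E} (hx : x ∈ F.S 1) : x ^ F.len = 0 := by
  have h := F.pow_mem hx F.len
  rwa [F.eq_bot, AddSubgroup.mem_bot] at h

/-- The congruence subgroup of units `u` with `u ≡ 1 ≡ u⁻¹` modulo the `j`-th term. The condition
on `u⁻¹` makes closure under inverses immediate. -/
def congr (j : ℕ) : Subgroup Eˣ where
  carrier := {u | (u : E) - 1 ∈ F.S j ∧ ((u⁻¹ : Eˣ) : E) - 1 ∈ F.S j}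
  one_mem' := by simp [(F.S j).zero_mem]
  mul_mem' := by
    have key : ∀ x y : E, x - 1 ∈ F.S j → y - 1 ∈ F.S j → x * y - 1 ∈ F.S j := by
      intro x y hx hy
      have h : (x - 1) * (y - 1) ∈ F.S j := by
        simpa using F.mul_mem hx (F.le_zero j hy)
      have e : x * y - 1 = (x - 1) * (y - 1) + (x - 1) + (y - 1) := by noncomm_ring
      rw [e]
      exact add_mem (add_mem h hx) hy
    rintro u v ⟨hu, hu'⟩ ⟨hv, hv'⟩
    refine ⟨by simpa using key _ _ hu hv, ?_⟩
    rw [mul_inv_rev]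
    simpa using key _ _ hv' hu'
  inv_mem' := by
    rintro u ⟨hu, hu'⟩
    exact ⟨hu', by simpa using hu⟩

lemma mem_congr {j : ℕ} {u : Eˣ} :
    u ∈ F.congr j ↔ (u : E) - 1 ∈ F.S j ∧ ((u⁻¹ : Eˣ) : E) - 1 ∈ F.S j := Iff.rfl

lemma coe_mem_zero {u : Eˣ} {j : ℕ} (hu : u ∈ F.congr j) : (u : E) ∈ F.S 0 := by
  have := add_mem (F.le_zero j hu.1) F.one_mem
  simpa using this

lemma commutator_sub_one_mem {u g : Eˣ} {j : ℕ} (hu : u ∈ F.congr j) (hg : g ∈ F.congr 1) :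
    ((u * g * u⁻¹ * g⁻¹ : Eˣ) : E) - 1 ∈ F.S (j + 1) ∧
      ((g * u * g⁻¹ * u⁻¹ : Eˣ) : E) - 1 ∈ F.S (j + 1) := by
  have h1 : ((u : E) - 1) * (g - 1) ∈ F.S (j + 1) := F.mul_mem hu.1 hg.1
  have h2 : ((g : E) - 1) * (u - 1) ∈ F.S (j + 1) := by
    rw [add_comm]; exact F.mul_mem hg.1 hu.1
  have hui := F.coe_mem_zero (inv_mem hu)
  have hgi := F.coe_mem_zero (inv_mem hg)
  -- `x y x⁻¹ y⁻¹ - 1 = ((x - 1) (y - 1) - (y - 1) (x - 1)) x⁻¹ y⁻¹`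
  have key : ∀ x y : Eˣ, ((x * y * x⁻¹ * y⁻¹ : Eˣ) : E) - 1 =
      (((x : E) - 1) * (y - 1) - (y - 1) * (x - 1)) * ((x⁻¹ : Eˣ) * (y⁻¹ : Eˣ)) := by
    intro x y
    have e : ((x : E) - 1) * (y - 1) - (y - 1) * (x - 1) = x * y - y * x := by noncomm_ring
    have e2 : (y : E) * x * ((x⁻¹ : Eˣ) * (y⁻¹ : Eˣ)) = 1 := by
      rw [← mul_assoc, mul_assoc (y : E), Units.mul_inv, mul_one, Units.mul_inv]
    rw [e, sub_mul, e2]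
    simp [mul_assoc]
  rw [key, key]
  have h3 := F.mul_mem (sub_mem h1 h2) (F.mul_mem hui hgi)
  have h4 := F.mul_mem (sub_mem h2 h1) (F.mul_mem hgi hui)
  exact ⟨h3, h4⟩

/-- The group of units congruent to `1` is nilpotent: the congruence subgroups form a central
series. -/
lemma isNilpotent_congr : Group.IsNilpotent (F.congr 1) := by
  rw [Subgroup.nilpotent_iff_finite_descending_central_series]
  refine ⟨F.len, fun j => (F.congr (j + 1)).subgroupOf (F.congr 1), ⟨?_, ?_⟩, ?_⟩
  · simp
  · intro x n hx g
    rw [Subgroup.mem_subgroupOf] at hx ⊢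
    have h := F.commutator_sub_one_mem hx g.2
    refine F.mem_congr.2 ⟨h.1, ?_⟩
    have e : ((x * g * x⁻¹ * g⁻¹ : F.congr 1) : Eˣ)⁻¹ = g * x * (g : Eˣ)⁻¹ * (x : Eˣ)⁻¹ := by
      simp [mul_assoc]
    change ((((x * g * x⁻¹ * g⁻¹ : F.congr 1) : Eˣ)⁻¹ : Eˣ) : E) - 1 ∈ F.S (n + 1 + 1)
    rw [e]
    exact h.2
  · rw [eq_bot_iff]
    intro x hx
    have h := F.succ_le _ (Subgroup.mem_subgroupOf.1 hx).1
    rw [F.eq_bot, AddSubgroup.mem_bot, sub_eq_zero] at h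
    exact Subtype.ext (Units.ext h)

/-- In characteristic zero a unit `u` congruent to `1` has infinite order or is `1`:
`u ^ r - 1 = (r + nilpotent) * (u - 1)`, and the first factor is a unit. -/
lemma eq_one_of_isOfFinOrder [Algebra ℚ E] (u : F.congr 1) (hu : IsOfFinOrder u) : u = 1 := by
  obtain ⟨r, hr, h⟩ := isOfFinOrder_iff_pow_eq_one.1 hu
  set x : E := ((u : Eˣ) : E) with hx
  have hxr : x ^ r = 1 := by
    have := congrArg (fun v : F.congr 1 => ((v : Eˣ) : E)) h
    simpa using this
  have hnil : IsNilpotent (x - 1) := ⟨F.len, F.pow_len_eq_zero u.2.1⟩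
  have hsum : IsNilpotent ((∑ i ∈ Finset.range r, x ^ i) - r) := by
    have e : (∑ i ∈ Finset.range r, x ^ i) - (r : E)
        = (∑ i ∈ Finset.range r, ∑ j ∈ Finset.range i, x ^ j) * (x - 1) := by
      rw [Finset.sum_mul]
      simp [geom_sum_mul]
    rw [e]
    refine Commute.isNilpotent_mul_left ?_ hnil
    refine Commute.sum_left _ _ _ fun i _ => Commute.sum_left _ _ _ fun j _ => ?_
    exact ((Commute.refl x).pow_left j).sub_right (Commute.one_right _)
  have hunit : IsUnit (∑ i ∈ Finset.range r, x ^ i) := by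
    have hr' : IsUnit ((r : E)) := by
      have : IsUnit (algebraMap ℚ E r) :=
        (IsUnit.mk0 (r : ℚ) (by exact_mod_cast hr.ne')).map _
      simpa using this
    have := hsum.isUnit_add_left_of_commute hr' (Nat.cast_commute r _).symm
    simpa using this
  have h0 : (∑ i ∈ Finset.range r, x ^ i) * (x - 1) = 0 := by
    rw [geom_sum_mul, hxr, sub_self]
  have := hunit.mul_right_eq_zero.1 h0
  exact Subtype.ext (Units.ext (by simpa [hx, sub_eq_zero] using this))

lemma isTorsionFreeNilpotent_congr [Algebra ℚ E] : IsTorsionFreeNilpotent (F.congr 1) :=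
  ⟨F.isNilpotent_congr, F.eq_one_of_isOfFinOrder⟩

lemma exists_congr_eq_one_add {x : E} (hx : x ∈ F.S 1) :
    ∃ u : F.congr 1, ((u : Eˣ) : E) = 1 + x := by
  have hpow : (-x) ^ F.len = 0 := F.pow_len_eq_zero (neg_mem hx)
  have h1 : (1 + x) * ∑ i ∈ Finset.range F.len, (-x) ^ i = 1 := by
    have := mul_neg_geom_sum (-x) F.len
    rwa [hpow, sub_neg_eq_add, sub_zero] at this
  have h2 : (∑ i ∈ Finset.range F.len, (-x) ^ i) * (1 + x) = 1 := by
    have := geom_sum_mul_neg (-x) F.len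
    rwa [hpow, sub_neg_eq_add, sub_zero] at this
  have h3 : (∑ i ∈ Finset.range F.len, (-x) ^ i) ∈ F.S 0 :=
    sum_mem fun i _ => F.le_zero i (F.pow_mem (neg_mem hx) i)
  refine ⟨⟨⟨1 + x, _, h1, h2⟩, ?_, ?_⟩, rfl⟩
  · simpa using hx
  · change (∑ i ∈ Finset.range F.len, (-x) ^ i) - 1 ∈ F.S 1
    have e : (∑ i ∈ Finset.range F.len, (-x) ^ i) - 1
        = -(x * ∑ i ∈ Finset.range F.len, (-x) ^ i) := by
      rw [← h1]; noncomm_ring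
    rw [e]
    simpa using neg_mem (F.mul_mem hx h3)

/-- The filtration of `End V` by the amount by which an operator raises a finite descending
filtration `W` of `V`. -/
def ofSubmodules {R V : Type*} [CommRing R] [AddCommGroup V] [Module R V]
    (W : ℕ → Submodule R V) (hW : Antitone W) (h0 : W 0 = ⊤) (n : ℕ) (hn : W n = ⊥) :
    NilpotentFiltration (Module.End R V) where
  S j :=
    { carrier := {f | ∀ m, ∀ v ∈ W m, f v ∈ W (m + j)}
      zero_mem' := fun m v _ => by simp
      add_mem' := fun hf hg m v hv => add_mem (hf m v hv) (hg m v hv)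
      neg_mem' := fun hf m v hv => by simpa using hf m v hv }
  one_mem := fun m v hv => by simpa using hv
  mul_mem := by
    intro i j x y hx hy m v hv
    have := hx _ _ (hy m v hv)
    rwa [add_assoc, add_comm j i] at this
  succ_le := fun i f hf m v hv => hW (by omega) (hf m v hv)
  len := n
  eq_bot := by
    rw [eq_bot_iff]
    intro f hf
    ext v
    have := hf 0 v (by simp [h0])
    rwa [zero_add, hn, Submodule.mem_bot] at this

end NilpotentFiltration

/-! ### Weighted free algebra -/

section FreeAlgebra

variable (k : ℕ)

/-- The variable `X_i` of the free algebra on `X_0, …, X_{k-1}`, with `X_i = 0` for `i ≥ k`. -/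
noncomputable def X (i : ℕ) : FreeAlgebra ℚ (Fin k) :=
  if h : i < k then FreeAlgebra.ι ℚ ⟨i, h⟩ else 0

lemma X_val (i : Fin k) : X k i = FreeAlgebra.ι ℚ i := by simp [X]

/-- The weight of a word, where the variable `X_i` has weight `i + 1`. -/
def weight (l : List (Fin k)) : ℕ := (l.map fun i : Fin k => (i : ℕ) + 1).sum

/-- The span of the monomials of weight at least `n`. -/
noncomputable def W (n : ℕ) : Submodule ℚ (FreeAlgebra ℚ (Fin k)) :=
  Submodule.span ℚ
    ((fun l : List (Fin k) => (l.map (FreeAlgebra.ι ℚ)).prod) '' {l | n ≤ weight k l})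

variable {k}

lemma prod_mem_W {l : List (Fin k)} {n : ℕ} (h : n ≤ weight k l) :
    (l.map (FreeAlgebra.ι ℚ)).prod ∈ W k n :=
  Submodule.subset_span ⟨l, h, rfl⟩

lemma W_antitone : Antitone (W k) := fun _ _ hij =>
  Submodule.span_mono (Set.image_mono fun _ hl => le_trans hij hl)

lemma mul_mem_W {i j : ℕ} {x y : FreeAlgebra ℚ (Fin k)} (hx : x ∈ W k i) (hy : y ∈ W k j) :
    x * y ∈ W k (i + j) := by
  have h : W k i * W k j ≤ W k (i + j) := by
    rw [W, W, Submodule.span_mul_span, Submodule.span_le]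
    rintro _ ⟨_, ⟨l, hl, rfl⟩, _, ⟨l', hl', rfl⟩, rfl⟩
    have : i + j ≤ weight k (l ++ l') := by
      have e : weight k (l ++ l') = weight k l + weight k l' := by simp [weight]
      rw [e]
      exact add_le_add hl hl'
    simpa using prod_mem_W this
  exact h (Submodule.mul_mem_mul hx hy)

lemma one_mem_W_zero : (1 : FreeAlgebra ℚ (Fin k)) ∈ W k 0 := by
  simpa using prod_mem_W (k := k) (l := []) (Nat.zero_le _)

lemma X_mem_W (i : ℕ) : X k i ∈ W k (i + 1) := by
  unfold X
  split_ifs with h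
  · simpa using prod_mem_W (k := k) (l := [⟨i, h⟩]) (n := i + 1) (by simp [weight])
  · exact zero_mem _

lemma W_zero : W k 0 = ⊤ := by
  rw [Submodule.eq_top_iff']
  intro x
  induction x using FreeAlgebra.induction with
  | grade0 r =>
    rw [Algebra.algebraMap_eq_smul_one]
    exact Submodule.smul_mem _ _ one_mem_W_zero
  | grade1 i =>
    have h : (0 : ℕ) ≤ i + 1 := Nat.zero_le _
    have h' := W_antitone h (X_mem_W (k := k) i)
    rwa [X_val] at h'
  | mul x y hx hy => simpa using mul_mem_W hx hy
  | add x y hx hy => exact add_mem hx hy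

variable (k) in
/-- The algebra endomorphism with `1 + X_i ↦ (1 + X_i) (1 + X_{i+1})`, which mirrors conjugation
by `t`. -/
noncomputable def shear : FreeAlgebra ℚ (Fin k) →ₐ[ℚ] FreeAlgebra ℚ (Fin k) :=
  FreeAlgebra.lift ℚ fun i => X k i + X k (i + 1) + X k i * X k (i + 1)

lemma shear_X (i : ℕ) : shear k (X k i) = X k i + X k (i + 1) + X k i * X k (i + 1) := by
  by_cases h : i < k
  · have e : X k i = FreeAlgebra.ι ℚ ⟨i, h⟩ := X_val k ⟨i, h⟩
    conv_lhs => rw [e]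
    simp [shear]
  · have h' : ¬ i + 1 < k := by omega
    simp [X, h, h']

lemma shear_X_sub_mem (i : ℕ) : shear k (X k i) - X k i ∈ W k (i + 1 + 1) := by
  have e : shear k (X k i) - X k i = X k (i + 1) + X k i * X k (i + 1) := by
    rw [shear_X]; abel
  rw [e]
  exact add_mem (X_mem_W _) (W_antitone (by omega) (mul_mem_W (X_mem_W i) (X_mem_W (i + 1))))

/-- The endomorphism `shear` is unipotent for the weight filtration. -/
lemma shear_sub_mem {n : ℕ} {x : FreeAlgebra ℚ (Fin k)} (hx : x ∈ W k n) :
    shear k x - x ∈ W k (n + 1) := by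
  have key : ∀ l : List (Fin k), shear k (l.map (FreeAlgebra.ι ℚ)).prod
      - (l.map (FreeAlgebra.ι ℚ)).prod ∈ W k (weight k l + 1) := by
    intro l
    induction l with
    | nil => simp
    | cons i l ih =>
      set p := (l.map (FreeAlgebra.ι ℚ)).prod with hp
      have hpm : p ∈ W k (weight k l) := prod_mem_W le_rfl
      have hsp : shear k p ∈ W k (weight k l) := by
        have := add_mem (W_antitone (Nat.le_succ _) ih) hpm
        simpa using this
      have e : shear k (((i :: l).map (FreeAlgebra.ι ℚ)).prod)
          - ((i :: l).map (FreeAlgebra.ι ℚ)).prod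
          = (shear k (X k i) - X k i) * shear k p + X k i * (shear k p - p) := by
        rw [List.map_cons, List.prod_cons, ← hp, map_mul, X_val]
        noncomm_ring
      have ew : weight k (i :: l) = i + 1 + weight k l := by simp [weight]
      rw [e, ew]
      refine add_mem (W_antitone (by omega) (mul_mem_W (shear_X_sub_mem i) hsp))
        (W_antitone (by omega) (mul_mem_W (X_mem_W i) ih))
  induction hx using Submodule.span_induction with
  | mem x h =>
    obtain ⟨l, hl, rfl⟩ := h
    exact W_antitone (Nat.succ_le_succ hl) (key l)
  | zero => simp
  | add x y _ _ hx hy =>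
    rw [map_add, add_sub_add_comm]
    exact add_mem hx hy
  | smul a x _ hx =>
    rw [map_smul, ← smul_sub]
    exact Submodule.smul_mem _ _ hx

lemma mul_left_mem_W {n : ℕ} (x : FreeAlgebra ℚ (Fin k)) {y : FreeAlgebra ℚ (Fin k)}
    (hy : y ∈ W k n) : x * y ∈ W k n := by
  have hx : x ∈ W k 0 := by simp [W_zero]
  simpa using mul_mem_W hx hy

lemma shear_mem_W {n : ℕ} {x : FreeAlgebra ℚ (Fin k)} (hx : x ∈ W k n) : shear k x ∈ W k n := by
  simpa using add_mem (W_antitone (Nat.le_succ n) (shear_sub_mem hx)) hx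

end FreeAlgebra

/-! ### Unipotent operators on the truncated free algebra -/

section Truncation

variable (k n : ℕ)

/-- The free algebra truncated at weight `n`, as a vector space. -/
abbrev Trunc : Type := FreeAlgebra ℚ (Fin k) ⧸ W k n

/-- Left multiplication on the truncated free algebra. -/
noncomputable def mulTrunc (x : FreeAlgebra ℚ (Fin k)) : Module.End ℚ (Trunc k n) :=
  (W k n).mapQ (W k n) (LinearMap.mulLeft ℚ x) fun _ hy => mul_left_mem_W x hy

/-- The operator induced by `shear` on the truncated free algebra. -/
noncomputable def shearTrunc : Module.End ℚ (Trunc k n) :=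
  (W k n).mapQ (W k n) (shear k).toLinearMap fun _ hy => shear_mem_W hy

/-- The filtration on the operators of the truncated free algebra that comes from weights. -/
noncomputable def truncFiltration : NilpotentFiltration (Module.End ℚ (Trunc k n)) :=
  .ofSubmodules (fun m => (W k m).map (W k n).mkQ)
    (fun _ _ h => Submodule.map_mono (W_antitone h))
    (by rw [W_zero, Submodule.map_top, Submodule.range_mkQ]) n
    (by rw [← le_bot_iff, Submodule.map_le_iff_le_comap]; simp)

/-- The group of operators on the truncated free algebra that are unipotent for the weight
filtration. -/
abbrev TruncGroup : Type := (truncFiltration k n).congr 1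

lemma mulTrunc_X_mem (i : ℕ) : mulTrunc k n (X k i) ∈ (truncFiltration k n).S 1 := by
  rintro m _ ⟨v, hv, rfl⟩
  refine ⟨X k i * v, ?_, rfl⟩
  exact W_antitone (by omega) (mul_mem_W (X_mem_W i) hv)

lemma shearTrunc_sub_one_mem : shearTrunc k n - 1 ∈ (truncFiltration k n).S 1 := by
  rintro m _ ⟨v, hv, rfl⟩
  exact ⟨shear k v - v, shear_sub_mem hv, rfl⟩

variable {k n} in
/-- The inclusion of the group of unipotent operators into the algebra of operators. -/
noncomputable def TruncGroup.toEnd : TruncGroup k n →* Module.End ℚ (Trunc k n) :=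
  (Units.coeHom _).comp (Subgroup.subtype _)

variable {k n} in
lemma TruncGroup.toEnd_injective :
    Function.Injective (TruncGroup.toEnd : TruncGroup k n → Module.End ℚ (Trunc k n)) :=
  fun _ _ h => Subtype.ext (Units.ext h)

/-- There are unipotent operators `1 + X_i` and a unipotent operator `t` on the truncated free
algebra that satisfy `[1 + X_i, t] = 1 + X_{i+1}`. The inverse of `t` is `shear`, as conjugation
of a left multiplication by an algebra automorphism applies the automorphism to the factor. -/
lemma exists_truncGroup :
    ∃ (u : ℕ → TruncGroup k n) (t : TruncGroup k n),
      (∀ i, (u i).toEnd = 1 + mulTrunc k n (X k i)) ∧ ∀ i, comm (u i) t = u (i + 1) := by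
  choose u hu using fun i => (truncFiltration k n).exists_congr_eq_one_add (mulTrunc_X_mem k n i)
  obtain ⟨s, hs⟩ := (truncFiltration k n).exists_congr_eq_one_add (shearTrunc_sub_one_mem k n)
  rw [add_sub_cancel] at hs
  replace hu : ∀ i, TruncGroup.toEnd (u i) = 1 + mulTrunc k n (X k i) := hu
  replace hs : TruncGroup.toEnd s = shearTrunc k n := hs
  refine ⟨u, s⁻¹, hu, fun i => ?_⟩
  have h : s * u i = u i * u (i + 1) * s := by
    apply TruncGroup.toEnd_injective
    rw [map_mul, map_mul, map_mul, hs, hu, hu]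
    refine Submodule.linearMap_qext _ (LinearMap.ext fun x => ?_)
    change (Submodule.Quotient.mk (shear k (x + X k i * x)) : Trunc k n) =
      Submodule.Quotient.mk ((shear k x + X k (i + 1) * shear k x)
        + X k i * (shear k x + X k (i + 1) * shear k x))
    congr 1
    rw [map_add, map_mul, shear_X]
    noncomm_ring
  rw [comm, inv_inv, mul_assoc (u i)⁻¹, h]
  group

end Truncation

/-! ### Words and path operators -/

section Syllables

variable {ι G : Type*} [Group G]

/-- The product of the powers `b i ^ e` over a list of syllables `(i, e)`. -/
def syllProd (b : ι → G) (L : List (ι × ℤ)) : G := (L.map fun p => b p.1 ^ p.2).prod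

/-- A list of syllables is reduced if all exponents are nonzero and neighbouring indices differ. -/
def IsReducedSyll (L : List (ι × ℤ)) : Prop :=
  (∀ p ∈ L, p.2 ≠ 0) ∧ L.IsChain fun p q => p.1 ≠ q.1

lemma exists_reduced_zpow_mul (b : ι → G) (i : ι) (e : ℤ) (L : List (ι × ℤ))
    (hL : IsReducedSyll L) :
    ∃ L', IsReducedSyll L' ∧ syllProd b L' = b i ^ e * syllProd b L := by
  classical
  by_cases he : e = 0
  · exact ⟨L, hL, by simp [he]⟩
  cases L with
  | nil => exact ⟨[(i, e)], ⟨by simpa using he, by simp⟩, by simp [syllProd]⟩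
  | cons p L =>
    obtain ⟨j, f⟩ := p
    by_cases hij : i = j
    · subst hij
      by_cases hef : e + f = 0
      · refine ⟨L, ⟨fun p hp => hL.1 p (by simp [hp]), hL.2.tail⟩, ?_⟩
        simp [syllProd, ← mul_assoc, ← zpow_add, hef]
      · refine ⟨(i, e + f) :: L, ⟨?_, ?_⟩, ?_⟩
        · intro p hp
          rcases List.mem_cons.1 hp with rfl | hp
          · exact hef
          · exact hL.1 p (by simp [hp])
        · have := hL.2
          rw [List.isChain_cons] at this ⊢
          exact this
        · simp [syllProd, zpow_add, mul_assoc]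
    · refine ⟨(i, e) :: (j, f) :: L, ⟨?_, ?_⟩, by simp [syllProd]⟩
      · intro p hp
        rcases List.mem_cons.1 hp with rfl | hp
        · exact he
        · exact hL.1 p hp
      · exact List.isChain_cons_cons.2 ⟨hij, hL.2⟩

lemma exists_reduced_of_mem_closure (b : ι → G) {g : G}
    (hg : g ∈ Subgroup.closure (Set.range b)) :
    ∃ L, IsReducedSyll L ∧ syllProd b L = g := by
  induction hg using Subgroup.closure_induction_left with
  | one => exact ⟨[], ⟨by simp, by simp⟩, by simp [syllProd]⟩
  | mul_left x hx y _ ih =>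
    obtain ⟨i, rfl⟩ := hx
    obtain ⟨L, hL, rfl⟩ := ih
    simpa using exists_reduced_zpow_mul b i 1 L hL
  | inv_mul_cancel x hx y _ ih =>
    obtain ⟨i, rfl⟩ := hx
    obtain ⟨L, hL, rfl⟩ := ih
    simpa using exists_reduced_zpow_mul b i (-1) L hL

variable [DecidableEq ι]

/-- The path operator of the letter `i` for a word `w`: it moves the value at `j + 1` to `j` at
each position `j` where `w` has the letter `i`. -/
def pathOp (w : List ι) (i : ι) : Module.End ℚ (ℕ → ℚ) where
  toFun f j := if w[j]? = some i then f (j + 1) else 0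
  map_add' f g := by ext j; by_cases h : w[j]? = some i <;> simp [h]
  map_smul' c f := by ext j; by_cases h : w[j]? = some i <;> simp [h]

lemma pathOp_apply (w : List ι) (i : ι) (f : ℕ → ℚ) (j : ℕ) :
    pathOp w i f j = if w[j]? = some i then f (j + 1) else 0 := rfl

lemma pathOp_prod_apply (w : List ι) (f : ℕ → ℚ) (l : List ι) (hl : l ≠ []) (j : ℕ)
    (h : w.length < j + l.length) : (l.map (pathOp w)).prod f j = 0 := by
  induction l generalizing j with
  | nil => exact absurd rfl hl
  | cons i l ih =>
    rw [List.map_cons, List.prod_cons, Module.End.mul_apply, pathOp_apply]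
    split_ifs with hj
    · have hj' : j < w.length := (List.getElem?_eq_some_iff.1 hj).1
      rw [List.length_cons] at h
      refine ih ?_ _ (by omega)
      rintro rfl
      simp at h
      omega
    · rfl

lemma pathOp_prod_eq_zero (w l : List ι) (h : w.length < l.length) :
    (l.map (pathOp w)).prod = 0 := by
  refine LinearMap.ext fun f => funext fun j => pathOp_prod_apply w f l ?_ j (by omega)
  rintro rfl
  simp at h

lemma pathOp_pathOp {w : List ι} (hw : w.IsChain (· ≠ ·)) (i : ι) (f : ℕ → ℚ) :
    pathOp w i (pathOp w i f) = 0 := by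
  funext j
  rw [pathOp_apply, pathOp_apply, Pi.zero_apply]
  split_ifs with h1 h2
  · obtain ⟨h, e⟩ := List.getElem?_eq_some_iff.1 h1
    obtain ⟨h', e'⟩ := List.getElem?_eq_some_iff.1 h2
    exact absurd (e.trans e'.symm) (List.isChain_iff_getElem.1 hw j h')
  · rfl
  · rfl

/-- Applying the operators `1 + e N_i` of the syllables of a tail of the word `w` to the indicator
of the end of the path gives a function that starts at the position of that tail, with the product
of the exponents as its first value. -/
lemma foldr_pathOp (L₁ L₂ : List (ι × ℤ)) (w : List ι) (hw : w = (L₁ ++ L₂).map Prod.fst) :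
    ∃ g : ℕ → ℚ,
      g = L₂.foldr (fun p f => f + (p.2 : ℚ) • pathOp w p.1 f) (Pi.single w.length 1) ∧
      g L₁.length = (L₂.map fun p => (p.2 : ℚ)).prod ∧ ∀ j < L₁.length, g j = 0 := by
  induction L₂ generalizing L₁ with
  | nil =>
    have e : w.length = L₁.length := by simp [hw]
    refine ⟨_, rfl, by simp [e], fun j hj => ?_⟩
    simp [e, hj.ne]
  | cons p L₂ ih =>
    obtain ⟨g, hg, hg1, hg0⟩ := ih (L₁ ++ [p]) (by simp [hw])
    have hlen : (L₁ ++ [p]).length = L₁.length + 1 := by simp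
    rw [hlen] at hg1 hg0
    refine ⟨g + (p.2 : ℚ) • pathOp w p.1 g, by rw [hg]; rfl, ?_, fun j hj => ?_⟩
    · have hp : w[L₁.length]? = some p.1 := by simp [hw]
      simp [pathOp_apply, hp, hg1, hg0 L₁.length (by omega)]
    · simp [pathOp_apply, hg0 j (by omega), hg0 (j + 1) (by omega)]

end Syllables

/-- A linear map that intertwines the unit `u` with `1 + N`, where `N ^ 2 = 0`, intertwines `u ^ e`
with `1 + e N`. -/
lemma intertwine_zpow {V V' : Type*} [AddCommGroup V] [Module ℚ V] [AddCommGroup V'] [Module ℚ V']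
    (π : V →ₗ[ℚ] V') (u : (Module.End ℚ V)ˣ) (N : Module.End ℚ V') (hN : ∀ f, N (N f) = 0)
    (h : ∀ v, π ((u : Module.End ℚ V) v) = π v + N (π v)) (e : ℤ) (v : V) :
    π (((u ^ e : (Module.End ℚ V)ˣ) : Module.End ℚ V) v) = π v + (e : ℚ) • N (π v) := by
  have hinv : ∀ v, π (((u⁻¹ : (Module.End ℚ V)ˣ) : Module.End ℚ V) v) = π v - N (π v) := by
    intro v
    have h1 := h (((u⁻¹ : (Module.End ℚ V)ˣ) : Module.End ℚ V) v)
    rw [← Module.End.mul_apply, Units.mul_inv, Module.End.one_apply] at h1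
    have h2 := congrArg N h1
    rw [map_add, hN, add_zero] at h2
    rw [h2, h1]; abel
  induction e using Int.induction_on generalizing v with
  | zero => simp
  | succ e ih =>
    rw [zpow_add_one, Units.val_mul, Module.End.mul_apply, ih, h]
    simp only [map_add, hN, Int.cast_add, Int.cast_one, add_smul, one_smul, add_zero]
    abel
  | pred e ih =>
    rw [zpow_sub_one, Units.val_mul, Module.End.mul_apply, ih, hinv]
    simp only [map_sub, hN, Int.cast_sub, Int.cast_one, sub_smul, one_smul, sub_zero]
    abel

/-- Magnus' argument: for a suitable truncation a nonempty reduced word in the operators `1 + X_i`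
is nontrivial. Sending `X_i` to the path operators of the word maps the truncated algebra
compatibly to a space where the word has the product of its exponents as a matrix entry. -/
lemma syllProd_ne_one {k : ℕ} {L : List (Fin k × ℤ)} (hL : IsReducedSyll L) (hne : L ≠ []) :
    ∃ n, ∀ u : ℕ → TruncGroup k n,
      (∀ i, (u i).toEnd = 1 + mulTrunc k n (X k i)) → syllProd (fun i : Fin k => u i) L ≠ 1 := by
  set w := L.map Prod.fst with hw
  have hchain : w.IsChain (· ≠ ·) := by
    rw [hw, List.isChain_map]; exact hL.2
  set ρ : FreeAlgebra ℚ (Fin k) →ₐ[ℚ] Module.End ℚ (ℕ → ℚ) := FreeAlgebra.lift ℚ (pathOp w)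
  -- a letter has weight at most `k`, so a word of weight above `k |w|` has more than `|w|` letters
  set n := k * w.length + 1 with hn
  have hρ : W k n ≤ LinearMap.ker ρ.toLinearMap := by
    rw [W, Submodule.span_le]
    rintro _ ⟨l, hl, rfl⟩
    have hl' : weight k l ≤ l.length * k := by
      have := List.sum_le_card_nsmul (l.map fun i : Fin k => (i : ℕ) + 1) k (by
        intro x hx
        obtain ⟨i, _, rfl⟩ := List.mem_map.1 hx
        exact i.2)
      rw [List.length_map, smul_eq_mul] at this
      exact this
    have hlen : w.length < l.length := by
      by_contra hcon
      have h1 : l.length * k ≤ w.length * k := Nat.mul_le_mul_right _ (by omega)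
      have h2 : n ≤ weight k l := hl
      rw [hn, mul_comm] at h2
      omega
    have e : ρ (l.map (FreeAlgebra.ι ℚ)).prod = (l.map (pathOp w)).prod := by
      rw [map_list_prod, List.map_map]
      congr 2
      funext i
      simp [ρ]
    change ρ (l.map (FreeAlgebra.ι ℚ)).prod = 0
    rw [e, pathOp_prod_eq_zero w l hlen]
  refine ⟨n, fun u hu hone => ?_⟩
  set δ : ℕ → ℚ := Pi.single w.length 1 with hδ
  set π : Trunc k n →ₗ[ℚ] (ℕ → ℚ) :=
    (LinearMap.applyₗ δ).comp ((W k n).liftQ ρ.toLinearMap hρ) with hπ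
  have hπmk : ∀ x, π (Submodule.Quotient.mk x) = ρ x δ := fun x => rfl
  have hπu : ∀ (i : Fin k) v,
      π ((u i).toEnd v) = π v + pathOp w i (π v) := by
    intro i v
    obtain ⟨x, rfl⟩ := Submodule.Quotient.mk_surjective _ v
    rw [hu, LinearMap.add_apply, map_add, Module.End.one_apply, hπmk]
    congr 1
    change ρ (X k i * x) δ = _
    rw [map_mul, X_val, Module.End.mul_apply]
    simp [ρ]
  have key : ∀ L' : List (Fin k × ℤ),
      π ((syllProd (fun i : Fin k => u i) L').toEnd (Submodule.Quotient.mk 1))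
      = L'.foldr (fun p f => f + (p.2 : ℚ) • pathOp w p.1 f) δ := by
    intro L'
    induction L' with
    | nil => simp [syllProd, hπmk]
    | cons p L' ih =>
      have e : syllProd (fun i : Fin k => u i) (p :: L')
          = u p.1 ^ p.2 * syllProd (fun i : Fin k => u i) L' := by simp [syllProd]
      rw [e, List.foldr_cons, ← ih, map_mul, Module.End.mul_apply]
      exact intertwine_zpow π (u p.1 : (Module.End ℚ (Trunc k n))ˣ) _
        (pathOp_pathOp hchain p.1) (hπu p.1) p.2 _
  have hL1 := key L
  rw [hone] at hL1
  obtain ⟨g, hg, hg0, -⟩ := foldr_pathOp [] L w hw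
  rw [← hg] at hL1
  have hwlen : w.length ≠ 0 := by simpa [hw] using hne
  have h0 : g 0 = 0 := by
    rw [← hL1]
    simp [hπmk, hδ, hwlen.symm]
  rw [List.length_nil, h0] at hg0
  obtain ⟨p, hp, hp0⟩ := List.mem_map.1 (List.prod_eq_zero_iff.1 hg0.symm)
  exact hL.1 p hp (by exact_mod_cast hp0)

/-! ### The Hydra group -/

section HydraGroup

variable (k : ℕ)

/-- The generator `t` of the Hydra group. -/
def genT : HydraGroup k := PresentedGroup.of Gen.t

/-- The iterated commutator `[a, t, …, t]` in the Hydra group, with `t` repeated `i` times. -/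
def genB (i : ℕ) : HydraGroup k := iterComm (PresentedGroup.of Gen.a) (genT k) i

lemma map_iterComm {G H : Type*} [Group G] [Group H] (f : G →* H) (x y : G) (n : ℕ) :
    f (iterComm x y n) = iterComm (f x) (f y) n := by
  induction n with
  | zero => rfl
  | succ n ih => simp [iterComm, comm, ih]

lemma genB_self : genB k k = 1 := by
  have h : PresentedGroup.mk {relator k} (relator k) = 1 :=
    PresentedGroup.one_of_mem (Set.mem_singleton _)
  rw [relator, map_iterComm] at h
  exact h

variable {k}

/-- A sequence `u` with `[u i, t] = u (i + 1)` and `u k = 1` gives a representation of the Hydra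
group. -/
lemma exists_hom {H : Type*} [Group H] (u : ℕ → H) (t : H)
    (h : ∀ i, comm (u i) t = u (i + 1)) (hk : u k = 1) :
    ∃ f : HydraGroup k →* H, f (genT k) = t ∧ ∀ i, f (genB k i) = u i := by
  have hit : ∀ i, iterComm (u 0) t i = u i := by
    intro i
    induction i with
    | zero => rfl
    | succ i ih => rw [iterComm, ih, h]
  let φ : Gen → H := fun x => match x with
    | .a => u 0
    | .t => t
  have hrel : ∀ r ∈ ({relator k} : Set (FreeGroup Gen)), FreeGroup.lift φ r = 1 := by
    rintro _ rfl
    rw [relator, map_iterComm, FreeGroup.lift_apply_of, FreeGroup.lift_apply_of]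
    exact (hit k).trans hk
  have ha : PresentedGroup.toGroup hrel (PresentedGroup.of Gen.a) = u 0 :=
    PresentedGroup.toGroup.of hrel
  have ht : PresentedGroup.toGroup hrel (genT k) = t := PresentedGroup.toGroup.of hrel
  refine ⟨PresentedGroup.toGroup hrel, ht, fun i => ?_⟩
  rw [genB, map_iterComm, ha, ht, hit]

variable (k)

/-- The subgroup generated by the iterated commutators `[a, t, …, t]`, including `a`. -/
def fiber : Subgroup (HydraGroup k) := Subgroup.closure (Set.range fun i : Fin k => genB k i)

lemma genB_of_le {i : ℕ} (hi : k ≤ i) : genB k i = 1 := by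
  induction i, hi using Nat.le_induction with
  | base => exact genB_self k
  | succ i _ ih =>
    change comm (genB k i) (genT k) = 1
    simp [ih, comm]

lemma genB_mem_fiber (i : ℕ) : genB k i ∈ fiber k := by
  by_cases hi : i < k
  · exact Subgroup.subset_closure ⟨⟨i, hi⟩, rfl⟩
  · rw [genB_of_le k (by omega)]; exact one_mem _

lemma inv_genT_conj_genB (i : ℕ) :
    (genT k)⁻¹ * genB k i * genT k = genB k i * genB k (i + 1) := by
  change _ = genB k i * comm (genB k i) (genT k)
  simp [comm, mul_assoc]

/-- Descending induction on `i`: `t b_i t⁻¹ = b_i (t b_{i+1} t⁻¹)⁻¹`. -/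
lemma genT_conj_genB_mem (i : ℕ) : genT k * genB k i * (genT k)⁻¹ ∈ fiber k := by
  obtain h | h := le_total k i
  · simp [genB_of_le k h]
  · induction h using Nat.decreasingInduction with
    | self => simp [genB_self]
    | of_succ i hi ih =>
      have e : genT k * genB k i * (genT k)⁻¹
          = genB k i * (genT k * genB k (i + 1) * (genT k)⁻¹)⁻¹ := by
        have := congrArg (fun x => genT k * x * (genT k)⁻¹ *
          (genT k * genB k (i + 1) * (genT k)⁻¹)⁻¹) (inv_genT_conj_genB k i)
        simp only [mul_assoc, mul_inv_rev, inv_inv, inv_mul_cancel_left, mul_inv_cancel_left,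
          mul_inv_cancel, mul_one] at this
        simp only [mul_assoc, mul_inv_rev, inv_inv]
        exact this.symm
      rw [e]
      exact mul_mem (genB_mem_fiber k i) (inv_mem ih)

lemma genT_mem_normalizer : genT k ∈ Subgroup.normalizer (fiber k : Set (HydraGroup k)) := by
  have h1 : ∀ x ∈ fiber k, genT k * x * (genT k)⁻¹ ∈ fiber k := by
    have : fiber k ≤ (fiber k).comap (MulAut.conj (genT k)).toMonoidHom := by
      conv_lhs => rw [fiber]
      rw [Subgroup.closure_le]
      rintro _ ⟨i, rfl⟩
      exact genT_conj_genB_mem k i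
    exact fun x hx => this hx
  have h2 : ∀ x ∈ fiber k, (genT k)⁻¹ * x * genT k ∈ fiber k := by
    have : fiber k ≤ (fiber k).comap (MulAut.conj (genT k)⁻¹).toMonoidHom := by
      conv_lhs => rw [fiber]
      rw [Subgroup.closure_le]
      rintro _ ⟨i, rfl⟩
      change (genT k)⁻¹ * genB k i * (genT k)⁻¹⁻¹ ∈ fiber k
      rw [inv_inv, inv_genT_conj_genB]
      exact mul_mem (genB_mem_fiber k i) (genB_mem_fiber k _)
    intro x hx
    simpa using this hx
  rw [Subgroup.mem_normalizer_iff]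
  refine fun x => ⟨h1 x, fun h => ?_⟩
  simpa [mul_assoc] using h2 _ h

lemma eq_top_of_mem {H : Subgroup (HydraGroup k)} (ha : genB k 0 ∈ H) (ht : genT k ∈ H) :
    H = ⊤ := by
  rw [eq_top_iff, ← PresentedGroup.closure_range_of, Subgroup.closure_le]
  rintro _ ⟨_ | _, rfl⟩
  · exact ha
  · exact ht

lemma fiber_normal : (fiber k).Normal := by
  rw [← Subgroup.normalizer_eq_top_iff]
  exact eq_top_of_mem k (Subgroup.le_normalizer (genB_mem_fiber k 0)) (genT_mem_normalizer k)

lemma exists_eq_mul_zpow (g : HydraGroup k) : ∃ x ∈ fiber k, ∃ m : ℤ, g = x * genT k ^ m := by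
  have := fiber_normal k
  have htop : fiber k ⊔ Subgroup.zpowers (genT k) = ⊤ :=
    eq_top_of_mem k (Subgroup.mem_sup_left (genB_mem_fiber k 0))
      (Subgroup.mem_sup_right (Subgroup.mem_zpowers _))
  obtain ⟨x, hx, _, ⟨m, rfl⟩, h⟩ :=
    Subgroup.mem_sup_of_normal_left.1 (htop ▸ Subgroup.mem_top g)
  exact ⟨x, hx, m, h.symm⟩

end HydraGroup

lemma isTorsionFreeNilpotent_of_injective {G H : Type} [Group G] [Group H] (f : G →* H)
    (hf : Function.Injective f) (hH : IsTorsionFreeNilpotent H) : IsTorsionFreeNilpotent G := by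
  refine ⟨?_, fun q hq => hf ?_⟩
  · have := hH.1
    exact Subgroup.isNilpotent_of_ker_le_center f (by simp [(MonoidHom.ker_eq_bot_iff f).2 hf])
  · rw [map_one]
    exact hH.2 _ (f.isOfFinOrder hq)

lemma exists_normal_of_hom {G H : Type} [Group G] [Group H] (f : G →* H)
    (hH : IsTorsionFreeNilpotent H) {g : G} (hg : f g ≠ 1) :
    ∃ (N : Subgroup G) (_ : N.Normal), g ∉ N ∧ IsTorsionFreeNilpotent (G ⧸ N) :=
  ⟨f.ker, inferInstance, hg, isTorsionFreeNilpotent_of_injective (QuotientGroup.kerLift f)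
    (QuotientGroup.kerLift_injective f) hH⟩

lemma isTorsionFreeNilpotent_int : IsTorsionFreeNilpotent (Multiplicative ℤ) := by
  refine ⟨inferInstance, fun q hq => ?_⟩
  obtain ⟨r, hr, h⟩ := isOfFinOrder_iff_pow_eq_one.1 hq
  have h' := congrArg Multiplicative.toAdd h
  rw [toAdd_pow, toAdd_one, smul_eq_zero] at h'
  exact Multiplicative.toAdd.injective (h'.resolve_left hr.ne')

end Hydra

theorem theorem1 (k : ℕ) (hk : 1 ≤ k) :
    Hydra.IsResidually Hydra.IsTorsionFreeNilpotent (Hydra.HydraGroup k) := by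
  open Hydra in
  intro g hg
  obtain ⟨x, hx, m, rfl⟩ := exists_eq_mul_zpow k g
  by_cases hm : m = 0
  · obtain ⟨L, hL, rfl⟩ := exists_reduced_of_mem_closure _ hx
    have hne : L ≠ [] := by
      rintro rfl
      simp [hm, syllProd] at hg
    obtain ⟨n, hn⟩ := syllProd_ne_one hL hne
    obtain ⟨u, t, hu, hut⟩ := exists_truncGroup k n
    have huk : u k = 1 := by
      apply TruncGroup.toEnd_injective
      rw [hu, map_one]
      have e : X k k = 0 := by simp [X]
      rw [e]
      refine Submodule.linearMap_qext _ (LinearMap.ext fun y => ?_)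
      simp [mulTrunc]
    obtain ⟨f, -, hf⟩ := exists_hom u t hut huk
    refine exists_normal_of_hom f (truncFiltration k n).isTorsionFreeNilpotent_congr ?_
    have e : f (syllProd (fun i : Fin k => genB k i) L) = syllProd (fun i : Fin k => u i) L := by
      simp [syllProd, map_list_prod, Function.comp_def, hf]
    rw [hm, zpow_zero, mul_one, e]
    exact hn u hu
  · -- the exponent sum of `t`
    obtain ⟨f, hft, hfb⟩ := exists_hom (k := k) (fun _ => (1 : Multiplicative ℤ))
      (Multiplicative.ofAdd 1) (fun _ => by simp [Hydra.comm]) rfl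
    refine exists_normal_of_hom f isTorsionFreeNilpotent_int ?_
    have hfx : f x = 1 := by
      have : fiber k ≤ f.ker := by
        rw [fiber, Subgroup.closure_le]
        rintro _ ⟨i, rfl⟩
        exact hfb i
      exact this hx
    rw [map_mul, map_zpow, hfx, hft, one_mul, ← ofAdd_zsmul]
    simpa using hm
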